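/- Let $R$ be a commutative unital ring and let $G$ be a finite, simple, strongly connected directed graph with vertex set $V$. A cut-vertex is a vertex whose removal disconnects the underlying undirected graph; the strong blocks $G_e$ ($e\in E$) of $G$ are the maximal connected subgraphs without cut-vertices, and $p_e := |V(G_e)|$. For each $e\in E$ let $a_e\in R$ and let $D^*_{G_e}\in R^{p_e\times p_e}$ be a matrix with all diagonal entries $1$ (rows and columns indexed by $V(G_e)$). Let $J$ and $\mathbf e$ denote the all-ones matrix and vector. The multiplicative distance matrix $D^*_G=(m_{ij})_{i,j\in V}$ has principal submatrices $D^*_{G_e}$ over $V(G_e)$, and if $i,j$ lie in no common block, $m_{ij}:=m_{iv}m_{vj}$ for any cut-vertex $v\neq i,j$ separating $i$ from $j$ (i.e. lying on every path from $i$ to $j$ in the underlying undirected graph). The additive-multiplicative distance matrix $D_{\mathcal G}=(d_{ij})_{i,j\in V}$ has principal submatrices $D_{\mathcal G_e}:=a_e(D^*_{G_e}-J)$, and $d_{ij}:=d_{iv}+m_{iv}d_{vj}$ for such $i,j,v$ (these values do not depend on $v$). For a vertex $v_0$ of $G$, put $$\kappa(D_{\mathcal G}) := \det\bigl(d_{ij}-d_{iv_0}-m_{iv_0}d_{v_0j}\bigr)_{i,j\in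 V\setminus\{v_0\}};$$ this does not depend on $v_0$. Define $\kappa(D_{\mathcal G_e})$ in the same way from $D_{\mathcal G_e}$, $D^*_{G_e}$ and a vertex of $G_e$. Assume that all $a_e$, and the matrices $D^*_G$ and $D_{\mathcal G}$, are invertible over $R$. Put $$\alpha_{\mathcal G}:=\frac{\det(D_{\mathcal G})}{\kappa(D_{\mathcal G})},\qquad \boldsymbol\tau_{\rm in}^T:=\mathbf e^T(D^*_G)^{-1},\qquad \boldsymbol\tau_{\rm out}:=(D^*_G)^{-1}\mathbf e .$$ For a vertex $i$ of a block $e$ let $G_{i\to e}$ be the largest connected induced subgraph of $G$ that contains $e$ and of which $i$ is not a cut-vertex. For $i\in V$ let $$\beta_i:=\frac{\kappa(D_{\mathcal G})}{\det(D_{\mathcal G})}\sum_{e\in E:\ i\in e}\frac1{a_e}\sum_{f\in E:\ f\subset G_{i\to e}}\frac{\det(D_{\mathcal G_f})}{\kappa(D_{\mathcal G_f})},$$ and let $C_{\mathcal G}\in R^{V\times V}$ have entries $(C_{\mathcal G})_{ii}=\beta_i$ and, for $j\ne i$, $(C_{\mathcal G})_{ij}=\beta_i-\frac1{a_e}$,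 where $e\ni i$ is the unique block containing $i$ with $j\in G_{i\to e}$. The additive-multiplicative Laplacian $L_{\mathcal G}=(l_{ij})\in R^{V\times V}$ is given by $l_{ij}=-\frac1{a_e}\bigl((D^*_G)^{-1}\bigr)_{ij}$ if $i\neq j$ lie in a common block $e$, $l_{ij}=0$ if $i,j$ lie in no common block, and $l_{jj}=-\sum_{k\neq j}l_{kj}$. Then $\kappa(D_{\mathcal G})$ and all $\kappa(D_{\mathcal G_f})$, $f \in E$, are units of $R$ (so that everything above is well defined), and $$C_{\mathcal G}=\bigl(-L_{\mathcal G}+C_{\mathcal G}\,\mathrm{diag}(\boldsymbol\tau_{\rm in})\bigr)D^*_G .$$ In particular, $$D_{\mathcal G}^{-1}=\frac1{\alpha_{\mathcal G}}\,\boldsymbol\tau_{\rm out}\boldsymbol\tau_{\rm in}^T-L_{\mathcal G}+C_{\mathcal G}\,\mathrm{diag}(\boldsymbol\tau_{\rm in}).$$ (Both identities hold with the $\kappa$'s computed at arbitrary vertices. Trees are the case where every block is a single edge.) -/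

import Mathlib

open scoped Matrix Ring

namespace AddMult

/-- A directed graph is strongly connected if there is a directed path from any vertex to any
vertex. -/
def StronglyConnected {V : Type*} (G : Digraph V) : Prop :=
  ∀ u v : V, Relation.ReflTransGen G.Adj u v

/-- The underlying undirected simple graph of a directed graph. -/
abbrev underlying {V : Type*} (G : Digraph V) : SimpleGraph V :=
  G.toSimpleGraphInclusive

/-- The vertex `v` is a cut-vertex of the subgraph induced on `S`: it lies in `S` and its removal
disconnects the underlying undirected graph (the empty graph does not count as disconnected). -/
def IsCutVertexOf {V : Type*} (G : Digraph V) (S : Set V) (v : V) : Prop :=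
  v ∈ S ∧ ¬ ((underlying G).induce (S \ {v})).Preconnected

/-- The subgraph induced on `S` is connected and has no cut-vertex. -/
def NoCutVertex {V : Type*} (G : Digraph V) (S : Set V) : Prop :=
  ((underlying G).induce S).Connected ∧ ∀ v : V, ¬ IsCutVertexOf G S v

/-- The strong blocks of `G`, given by their vertex sets: the maximal connected subgraphs without
cut-vertices (a maximal such subgraph is automatically induced). -/
def Block {V : Type*} (G : Digraph V) : Type _ :=
  {S : Finset V // Maximal (fun T : Finset V => NoCutVertex G (T : Set V)) S}

/-- The vertex set of a block. -/
def Block.verts {V : Type*} {G : Digraph V} (e : Block G) : Finset V := e.1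

noncomputable instance {V : Type*} [Fintype V] (G : Digraph V) : Fintype (Block G) := by
  classical
  exact Fintype.ofInjective (fun e : Block G => e.verts) Subtype.val_injective

/-- The vertices `i` and `j` lie in a common block. -/
def SameBlock {V : Type*} (G : Digraph V) (i j : V) : Prop :=
  ∃ e : Block G, i ∈ e.verts ∧ j ∈ e.verts

/-- The cut-vertex `v`, different from `i` and `j`, separates `i` from `j`: every path of the
underlying graph from `i` to `j` passes through `v`. -/
def Separates {V : Type*} (G : Digraph V) (v i j : V) : Prop :=
  v ≠ i ∧ v ≠ j ∧ (underlying G).Reachable i j ∧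
    ∀ p : (underlying G).Walk i j, v ∈ p.support

theorem Separates.dist_add_dist {V : Type*} {G : Digraph V} {v i j : V}
    (h : Separates G v i j) :
    0 < (underlying G).dist i v ∧ 0 < (underlying G).dist v j ∧
      (underlying G).dist i v + (underlying G).dist v j ≤ (underlying G).dist i j := by
  classical
  obtain ⟨hi, hj, hr, hp⟩ := h
  obtain ⟨p, hpl⟩ := hr.exists_walk_length_eq_dist
  have hv := hp p
  refine ⟨?_, ?_, ?_⟩
  · exact SimpleGraph.Reachable.pos_dist_of_ne ⟨p.takeUntil v hv⟩ hi.symm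
  · exact SimpleGraph.Reachable.pos_dist_of_ne ⟨p.dropUntil v hv⟩ hj
  · have h1 := SimpleGraph.dist_le (p.takeUntil v hv)
    have h2 := SimpleGraph.dist_le (p.dropUntil v hv)
    have h3 := congrArg SimpleGraph.Walk.length (p.take_spec hv)
    rw [SimpleGraph.Walk.length_append] at h3
    omega

theorem Separates.dist_left_lt {V : Type*} {G : Digraph V} {v i j : V}
    (h : Separates G v i j) : (underlying G).dist i v < (underlying G).dist i j := by
  have := h.dist_add_dist
  omega

theorem Separates.dist_right_lt {V : Type*} {G : Digraph V} {v i j : V}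
    (h : Separates G v i j) : (underlying G).dist v j < (underlying G).dist i j := by
  have := h.dist_add_dist
  omega

/-- An additive-multiplicative block-datum on `G` over `R`: each block `e` carries a scalar
`a e` and a square matrix `Dstar e`, indexed by the vertices of `e`, with unit diagonal. -/
structure BlockDatum {V : Type*} (G : Digraph V) (R : Type*) [CommRing R] where
  a : Block G → R
  Dstar : (e : Block G) → Matrix e.verts e.verts R
  Dstar_diag : ∀ (e : Block G) (i : e.verts), Dstar e i i = 1

/-- The additive-multiplicative distance matrix `a_e (D^*_e - J)` of a block. -/
def BlockDatum.blockDist {V : Type*} {G : Digraph V} {R : Type*} [CommRing R]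
    (𝒢 : BlockDatum G R) (e : Block G) : Matrix e.verts e.verts R :=
  𝒢.a e • (𝒢.Dstar e - Matrix.of fun _ _ => 1)

open Classical in
/-- The entry `m_{ij}` of the multiplicative distance matrix: it is read off from the block
matrix if `i` and `j` lie in a common block, and otherwise `m_{ij} = m_{iv} m_{vj}` for a
cut-vertex `v` separating `i` from `j`. (In a connected graph one of these cases occurs, and the
value does not depend on the choices.) -/
noncomputable def BlockDatum.m {V : Type*} {G : Digraph V} {R : Type*} [CommRing R]
    (𝒢 : BlockDatum G R) (i j : V) : R :=
  if h : SameBlock G i j then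
    𝒢.Dstar h.choose ⟨i, h.choose_spec.1⟩ ⟨j, h.choose_spec.2⟩
  else if h : ∃ v, Separates G v i j then
    𝒢.m i h.choose * 𝒢.m h.choose j
  else 0
termination_by (underlying G).dist i j
decreasing_by
  · exact h.choose_spec.dist_left_lt
  · exact h.choose_spec.dist_right_lt

open Classical in
/-- The entry `d_{ij}` of the additive-multiplicative distance matrix: it is read off from the
block matrix if `i` and `j` lie in a common block, and otherwise `d_{ij} = d_{iv} + m_{iv} d_{vj}`
for a cut-vertex `v` separating `i` from `j`. -/
noncomputable def BlockDatum.d {V : Type*} {G : Digraph V} {R : Type*} [CommRing R]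
    (𝒢 : BlockDatum G R) (i j : V) : R :=
  if h : SameBlock G i j then
    𝒢.blockDist h.choose ⟨i, h.choose_spec.1⟩ ⟨j, h.choose_spec.2⟩
  else if h : ∃ v, Separates G v i j then
    𝒢.d i h.choose + 𝒢.m i h.choose * 𝒢.d h.choose j
  else 0
termination_by (underlying G).dist i j
decreasing_by
  · exact h.choose_spec.dist_left_lt
  · exact h.choose_spec.dist_right_lt

/-- The multiplicative distance matrix `D^*_G`. -/
noncomputable def BlockDatum.multDist {V : Type*} {G : Digraph V} {R : Type*} [CommRing R]
    (𝒢 : BlockDatum G R) : Matrix V V R :=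
  Matrix.of 𝒢.m

/-- The additive-multiplicative distance matrix `D_𝒢`. -/
noncomputable def BlockDatum.dist {V : Type*} {G : Digraph V} {R : Type*} [CommRing R]
    (𝒢 : BlockDatum G R) : Matrix V V R :=
  Matrix.of 𝒢.d

/-- The invariant `κ(D, v₀) = det (D' - u e^T - m(·, v₀) w^T)`, where `D'` is `D` with the row and
column of `v₀` removed, `u` and `w^T` are the column and the row of `v₀` in `D`, and `m(·, v₀)`
is the column of `v₀` in the multiplicative distance matrix `M` (all without the entry at
`v₀`). -/
def kappa {W : Type*} [Fintype W] [DecidableEq W] {R : Type*} [CommRing R]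
    (D M : Matrix W W R) (v₀ : W) : R :=
  (Matrix.of fun i j : {w : W // w ≠ v₀} => D i j - D i v₀ - M i v₀ * D v₀ j).det

section Inverse

variable {V : Type*} [Fintype V] [DecidableEq V] {G : Digraph V} {R : Type*} [CommRing R]

/-- `κ(D_𝒢, v₀)`. -/
noncomputable def BlockDatum.kappaG (𝒢 : BlockDatum G R) (v₀ : V) : R :=
  kappa 𝒢.dist 𝒢.multDist v₀

/-- `κ(D_{𝒢_e}, v)` for a vertex `v` of the block `e`. -/
def BlockDatum.kappaBlock (𝒢 : BlockDatum G R) (e : Block G) (v : e.verts) : R :=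
  kappa (𝒢.blockDist e) (𝒢.Dstar e) v

/-- `τ_in = ((D^*_G)^{-1})^T e`, that is `τ_in^T = e^T (D^*_G)^{-1}`. -/
noncomputable def BlockDatum.tauIn (𝒢 : BlockDatum G R) : V → R :=
  (fun _ => 1) ᵥ* 𝒢.multDist⁻¹

/-- `τ_out = (D^*_G)^{-1} e`. -/
noncomputable def BlockDatum.tauOut (𝒢 : BlockDatum G R) : V → R :=
  𝒢.multDist⁻¹ *ᵥ (fun _ => 1)

/-- `α_𝒢 = det(D_𝒢) / κ(D_𝒢, v₀)`. -/
noncomputable def BlockDatum.alpha (𝒢 : BlockDatum G R) (v₀ : V) : R :=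
  𝒢.dist.det * (𝒢.kappaG v₀)⁻¹ʳ

/-- The vertex set of `G_{i → e}`, the largest connected induced subgraph that contains the block
`e` and of which `i` is not a cut-vertex. The union of all such vertex sets is again one of them
(for a vertex `i` of `e`), so it is the largest one. -/
def branch (i : V) (e : Block G) : Set V :=
  ⋃₀ {S : Set V | (e.verts : Set V) ⊆ S ∧ ((underlying G).induce S).Connected ∧
    ¬ IsCutVertexOf G S i}

open Classical in
/-- `β_i = (κ(D_𝒢) / det(D_𝒢)) ∑_{e ∋ i} (1 / a_e) ∑_{f ⊆ G_{i → e}} det(D_{𝒢_f}) / κ(D_{𝒢_f})`,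
where the `κ` are computed at the vertices `v₀` of `G` and `b f` of the blocks `f`. -/
noncomputable def BlockDatum.beta (𝒢 : BlockDatum G R) (v₀ : V) (b : (f : Block G) → f.verts)
    (i : V) : R :=
  𝒢.kappaG v₀ * 𝒢.dist.det⁻¹ʳ *
    ∑ e : Block G with i ∈ e.verts, (𝒢.a e)⁻¹ʳ *
      ∑ f : Block G with (f.verts : Set V) ⊆ branch i e,
        (𝒢.blockDist f).det * (𝒢.kappaBlock f (b f))⁻¹ʳ

open Classical in
/-- The matrix `C_𝒢`: its `(i, i)` entry is `β_i`, and for `j ≠ i` its `(i, j)` entry is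
`β_i - 1 / a_e`, where `e` is the block containing `i` for which `j` lies in `G_{i → e}` (in a
connected graph there is exactly one). -/
noncomputable def BlockDatum.C (𝒢 : BlockDatum G R) (v₀ : V) (b : (f : Block G) → f.verts) :
    Matrix V V R :=
  Matrix.of fun i j =>
    if j = i then 𝒢.beta v₀ b i
    else if h : ∃ e : Block G, i ∈ e.verts ∧ j ∈ branch i e then
      𝒢.beta v₀ b i - (𝒢.a h.choose)⁻¹ʳ
    else 0

open Classical in
/-- The off-diagonal entries of the Laplacian: `-(1 / a_e) ((D^*_G)^{-1})_{ij}` if `i` and `j` lie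
in a common block `e` (which is then unique), and `0` otherwise. -/
noncomputable def BlockDatum.laplacianOff (𝒢 : BlockDatum G R) (i j : V) : R :=
  if h : SameBlock G i j then -(𝒢.a h.choose)⁻¹ʳ * 𝒢.multDist⁻¹ i j else 0

/-- The additive-multiplicative Laplacian `L_𝒢`; its columns sum to zero. -/
noncomputable def BlockDatum.laplacian (𝒢 : BlockDatum G R) : Matrix V V R :=
  Matrix.of fun i j =>
    if i = j then -∑ k ∈ Finset.univ.erase j, 𝒢.laplacianOff k j else 𝒢.laplacianOff i j

end Inverse

end AddMult

namespace AddMult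

section Graph

variable {V : Type*}

/-- Some walk of `H` from `x` to `y` avoids the vertex `v`. -/
def Avoid (H : SimpleGraph V) (v x y : V) : Prop :=
  ∃ p : H.Walk x y, v ∉ p.support

/-- No third vertex separates `x` from `y`. -/
def Insep (H : SimpleGraph V) (x y : V) : Prop :=
  ∀ v, v ≠ x → v ≠ y → Avoid H v x y

variable {H : SimpleGraph V} {u v w x y z i j : V}

theorem Avoid.refl (h : v ≠ x) : Avoid H v x x := ⟨.nil, by simpa using h⟩

theorem Avoid.symm (h : Avoid H v x y) : Avoid H v y x := by
  obtain ⟨p, hp⟩ := h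
  exact ⟨p.reverse, by simpa using hp⟩

theorem Avoid.trans (h : Avoid H v x y) (h' : Avoid H v y z) : Avoid H v x z := by
  obtain ⟨p, hp⟩ := h
  obtain ⟨q, hq⟩ := h'
  exact ⟨p.append q, by simp [SimpleGraph.Walk.mem_support_append_iff, hp, hq]⟩

theorem Avoid.ne_left (h : Avoid H v x y) : v ≠ x := by
  obtain ⟨p, hp⟩ := h
  rintro rfl
  exact hp p.start_mem_support

theorem Avoid.ne_right (h : Avoid H v x y) : v ≠ y := h.symm.ne_left

theorem Avoid.of_adj (h : H.Adj x y) (hx : v ≠ x) (hy : v ≠ y) : Avoid H v x y :=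
  ⟨h.toWalk, by simp [hx, hy]⟩

theorem Insep.refl (x : V) : Insep H x x := fun _ h _ => .refl h

theorem Insep.symm (h : Insep H x y) : Insep H y x := fun v hy hx => (h v hx hy).symm

theorem Insep.of_adj (h : H.Adj x y) : Insep H x y := fun _ hx hy => .of_adj h hx hy

theorem Insep.of_common (hxy : x ≠ y) (h₁ : Insep H u x) (h₂ : Insep H u y)
    (h₃ : Insep H w x) (h₄ : Insep H w y) : Insep H u w := by
  intro v hu hw
  by_cases hv : v = x
  · subst hv
    exact (h₂ v hu hxy).trans (h₄ v hw hxy).symm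
  · exact (h₁ v hu hv).trans (h₃ v hw hv).symm

theorem Avoid.of_reachable_induce {S : Set V} (hv : v ∉ S) {a b : S}
    (h : (H.induce S).Reachable a b) : Avoid H v a b := by
  obtain ⟨p⟩ := h
  refine ⟨p.map (SimpleGraph.Embedding.induce S).toHom, ?_⟩
  intro hmem
  have := SimpleGraph.Walk.support_map (SimpleGraph.Embedding.induce (G := H) S).toHom p
  erw [this] at hmem
  obtain ⟨c, -, hc⟩ := List.mem_map.1 hmem
  exact hv (hc ▸ c.2)

theorem avoid_of_dist_le (hH : H.Connected) (hvw : v ≠ w) (h : H.dist i w ≤ H.dist i v) :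
    Avoid H v i w := by
  classical
  obtain ⟨p, hp⟩ := hH.exists_walk_length_eq_dist i w
  refine ⟨p, fun hv => ?_⟩
  have h1 := SimpleGraph.dist_le (p.takeUntil v hv)
  have h3 := congrArg SimpleGraph.Walk.length (p.take_spec hv)
  rw [SimpleGraph.Walk.length_append] at h3
  have h4 : (p.dropUntil v hv).length ≠ 0 := fun h0 =>
    hvw (SimpleGraph.Walk.eq_of_length_eq_zero h0)
  omega

theorem exists_adj_dist_lt (hH : H.Connected) (hij : i ≠ j) :
    ∃ z, H.Adj z j ∧ H.dist i z < H.dist i j := by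
  obtain ⟨p, hp⟩ := hH.exists_walk_length_eq_dist j i
  cases p with
  | nil => exact absurd rfl hij
  | cons h q =>
    refine ⟨_, h.symm, ?_⟩
    have := SimpleGraph.dist_le q
    rw [SimpleGraph.Walk.length_cons] at hp
    rw [SimpleGraph.dist_comm, SimpleGraph.dist_comm (u := i)]
    omega

/-- A vertex on a path between inseparable vertices is inseparable from its ends. -/
theorem Insep.of_mem_path {s t : V} (h : Insep H s t) (p : H.Walk s t) (hp : p.IsPath)
    (hz : z ∈ p.support) : Insep H z s := by
  classical
  intro u huz hus
  by_cases hu : u ∈ (p.takeUntil z hz).support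
  · have hsp := p.take_spec hz
    have hd : u ∉ (p.dropUntil z hz).support := by
      intro hu'
      rw [← hsp] at hp
      have := hp.support_nodup
      rw [SimpleGraph.Walk.support_append] at this
      have h2 := List.disjoint_of_nodup_append this
      rw [SimpleGraph.Walk.mem_support_iff] at hu'
      rcases hu' with hu' | hu'
      · exact huz hu'
      · exact h2 hu hu'
    have hA : Avoid H u z t := ⟨_, hd⟩
    exact hA.trans (h u hus hA.ne_right).symm
  · exact Avoid.symm ⟨_, hu⟩

end Graph

section Blocks

variable {V : Type*} {G : Digraph V} {u v w x y z i j : V}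

theorem StronglyConnected.connected [Nonempty V] (hG : StronglyConnected G) :
    (underlying G).Connected := by
  refine ⟨fun u v => ?_⟩
  induction hG u v with
  | refl => rfl
  | @tail b c _ h ih =>
    refine ih.trans ?_
    by_cases hbc : b = c
    · rw [hbc]
    · exact SimpleGraph.Adj.reachable (by
        simp [underlying, Digraph.toSimpleGraphInclusive, hbc, h])

theorem NoCutVertex.insep {S : Set V} (hS : NoCutVertex G S) (hx : x ∈ S) (hy : y ∈ S) :
    Insep (underlying G) x y := by
  intro v hvx hvy
  by_cases hv : v ∈ S
  · have h := hS.2 v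
    simp only [IsCutVertexOf, hv, true_and, not_not] at h
    exact Avoid.of_reachable_induce (S := S \ {v}) (by simp)
      (h ⟨x, hx, by simpa using hvx.symm⟩ ⟨y, hy, by simpa using hvy.symm⟩)
  · exact Avoid.of_reachable_induce hv (hS.1.preconnected ⟨x, hx⟩ ⟨y, hy⟩)

/-- The set of vertices inseparable from two distinct inseparable vertices has no cut-vertex. -/
theorem noCutVertex_insep (hG : (underlying G).Connected) (hxy : x ≠ y)
    (h : Insep (underlying G) x y) :
    NoCutVertex G {z | Insep (underlying G) z x ∧ Insep (underlying G) z y} := by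
  classical
  set T := {z | Insep (underlying G) z x ∧ Insep (underlying G) z y} with hT
  have pair : ∀ {s t}, s ∈ T → t ∈ T → Insep (underlying G) s t := fun hs ht =>
    Insep.of_common hxy hs.1 hs.2 ht.1 ht.2
  have hxT : x ∈ T := ⟨.refl x, h⟩
  have hyT : y ∈ T := ⟨h.symm, .refl y⟩
  have conv : ∀ {s t}, s ∈ T → t ∈ T → ∀ p : (underlying G).Walk s t, p.IsPath →
      ∀ z ∈ p.support, z ∈ T := by
    intro s t hs ht p hp z hz
    by_cases hst : s = t
    · subst hst
      cases SimpleGraph.Walk.isPath_iff_nil.1 hp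
      simp only [SimpleGraph.Walk.support_nil, List.mem_singleton] at hz
      exact hz ▸ hs
    · have h1 := (pair hs ht).of_mem_path p hp hz
      have h2 := (pair ht hs).of_mem_path p.reverse hp.reverse (by simpa using hz)
      exact ⟨Insep.of_common hst h1 h2 (pair hxT hs) (pair hxT ht),
        Insep.of_common hst h1 h2 (pair hyT hs) (pair hyT ht)⟩
  have : Nonempty T := ⟨⟨x, hxT⟩⟩
  refine ⟨⟨fun s t => ?_⟩, fun v hv => hv.2 fun s t => ?_⟩
  · obtain ⟨p, hp⟩ := (hG.preconnected s.1 t.1).exists_isPath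
    exact ⟨p.induce T (conv s.2 t.2 p hp)⟩
  · obtain ⟨q, hq⟩ := pair s.2.1 t.2.1 v (fun h => s.2.2 h.symm) (fun h => t.2.2 h.symm)
    refine ⟨q.bypass.induce (T \ {v}) fun z hz =>
      ⟨conv s.2.1 t.2.1 _ q.bypass_isPath z hz, ?_⟩⟩
    rintro rfl
    exact hq (q.support_bypass_subset_support hz)

theorem Block.noCutVertex (e : Block G) : NoCutVertex G (e.verts : Set V) := e.2.prop

theorem Block.insep (e : Block G) (hx : x ∈ e.verts) (hy : y ∈ e.verts) :
    Insep (underlying G) x y :=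
  e.noCutVertex.insep (Finset.mem_coe.2 hx) (Finset.mem_coe.2 hy)

theorem Block.nonempty (e : Block G) : e.verts.Nonempty := by
  obtain ⟨x⟩ := e.noCutVertex.1.nonempty
  exact ⟨x.1, x.2⟩

theorem exists_block_of_noCutVertex [Fintype V] {S : Finset V}
    (hS : NoCutVertex G (S : Set V)) : ∃ e : Block G, S ⊆ e.verts := by
  obtain ⟨T, hST, hT⟩ := Finite.exists_le_maximal
    (p := fun T : Finset V => NoCutVertex G (T : Set V)) hS
  exact ⟨⟨T, hT⟩, hST⟩

theorem exists_mem_block [Fintype V] (i : V) : ∃ e : Block G, i ∈ e.verts := by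
  obtain ⟨e, he⟩ := exists_block_of_noCutVertex (G := G) (S := {i}) (by
    refine ⟨?_, fun v hv => hv.2 ?_⟩
    · simpa using SimpleGraph.Connected.of_subsingleton
    · obtain rfl : v = i := by simpa using hv.1
      rintro ⟨a, ha⟩
      simp at ha)
  exact ⟨e, he (by simp)⟩

theorem exists_block_of_insep [Fintype V] (hG : (underlying G).Connected) (hxy : x ≠ y)
    (h : Insep (underlying G) x y) :
    ∃ e : Block G, ∀ z, Insep (underlying G) z x → Insep (underlying G) z y → z ∈ e.verts := by
  classical
  obtain ⟨e, he⟩ := exists_block_of_noCutVertex (G := G)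
    (S := {z | Insep (underlying G) z x ∧ Insep (underlying G) z y}) (by
      simpa using noCutVertex_insep hG hxy h)
  exact ⟨e, fun z h1 h2 => he (by simp [h1, h2])⟩

theorem Block.mem_of_insep [Fintype V] (hG : (underlying G).Connected) (e : Block G) (hxy : x ≠ y)
    (hx : x ∈ e.verts) (hy : y ∈ e.verts) (h1 : Insep (underlying G) z x)
    (h2 : Insep (underlying G) z y) : z ∈ e.verts := by
  obtain ⟨e', he'⟩ := exists_block_of_insep hG hxy (e.insep hx hy)
  have : e.verts ⊆ e'.verts := fun t ht => he' t (e.insep ht hx) (e.insep ht hy)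
  exact e.2.le_of_ge e'.2.prop this (he' z h1 h2)

theorem Block.eq_of_mem [Fintype V] (hG : (underlying G).Connected) {e e' : Block G} (hxy : x ≠ y)
    (hx : x ∈ e.verts) (hy : y ∈ e.verts) (hx' : x ∈ e'.verts) (hy' : y ∈ e'.verts) :
    e = e' := by
  refine Subtype.ext (Finset.ext fun z => ⟨fun hz => ?_, fun hz => ?_⟩)
  · exact e'.mem_of_insep hG hxy hx' hy' (e.insep hz hx) (e.insep hz hy)
  · exact e.mem_of_insep hG hxy hx hy (e'.insep hz hx') (e'.insep hz hy')

theorem sameBlock_iff [Fintype V] (hG : (underlying G).Connected) :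
    SameBlock G x y ↔ Insep (underlying G) x y := by
  refine ⟨fun ⟨e, hx, hy⟩ => e.insep hx hy, fun h => ?_⟩
  by_cases hxy : x = y
  · subst hxy
    obtain ⟨e, he⟩ := exists_mem_block (G := G) x
    exact ⟨e, he, he⟩
  · obtain ⟨e, he⟩ := exists_block_of_insep hG hxy h
    exact ⟨e, he x (.refl x) h, he y h.symm (.refl y)⟩

theorem Block.exists_mem_ne [Fintype V] (hG : (underlying G).Connected) (e : Block G)
    (hij : i ≠ j) : ∃ x ∈ e.verts, x ≠ i := by
  obtain ⟨z, hz, -⟩ := exists_adj_dist_lt hG hij.symm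
  by_contra! hcon
  obtain ⟨e', he'⟩ := exists_block_of_insep hG hz.ne (.of_adj hz)
  have : e.verts ⊆ e'.verts := fun t ht => by
    rw [hcon t ht]
    exact he' i (.of_adj hz.symm) (.refl i)
  exact hz.ne (hcon z (e.2.le_of_ge e'.2.prop this (he' z (.refl z) (.of_adj hz))))

theorem separates_iff (hG : (underlying G).Connected) :
    Separates G v i j ↔ v ≠ i ∧ v ≠ j ∧ ¬ Avoid (underlying G) v i j := by
  simp [Separates, Avoid, hG.preconnected i j]

theorem Separates.symm (h : Separates G v i j) : Separates G v j i :=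
  ⟨h.2.1, h.1, h.2.2.1.symm, fun p => by simpa using h.2.2.2 p.reverse⟩

theorem Separates.not_sameBlock [Fintype V] (hG : (underlying G).Connected)
    (h : Separates G v i j) :
    ¬ SameBlock G i j := by
  rw [separates_iff hG] at h
  rw [sameBlock_iff hG]
  exact fun h' => h.2.2 (h' v h.1 h.2.1)

/-- Two vertices separating `i` from `j` are met in the same order by all paths. -/
theorem Separates.order (hG : (underlying G).Connected) (hvw : v ≠ w)
    (hv : Separates G v i j) (hw : Separates G w i j) :
    (Separates G v i w ∧ Separates G w v j) ∨ (Separates G w i v ∧ Separates G v w j) := by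
  simp only [separates_iff hG] at *
  have key : ∀ k : V, Avoid (underlying G) v k w ∨ Avoid (underlying G) w k v := fun k =>
    (le_total ((underlying G).dist k w) ((underlying G).dist k v)).imp
      (avoid_of_dist_le hG hvw) (avoid_of_dist_le hG hvw.symm)
  rcases key i with h1 | h1
  · have h2 : ¬ Avoid (underlying G) v w j := fun h => hv.2.2 (h1.trans h)
    have h3 := (key j).resolve_left fun h => h2 h.symm
    exact .inr ⟨⟨hw.1, hvw.symm, fun h => hw.2.2 (h.trans h3.symm)⟩, hvw, hv.2.1, h2⟩
  · have h2 : ¬ Avoid (underlying G) w v j := fun h => hw.2.2 (h1.trans h)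
    have h3 := (key j).resolve_right fun h => h2 h.symm
    exact .inl ⟨⟨hv.1, hvw, fun h => hv.2.2 (h.trans h3.symm)⟩, hvw.symm, hw.2.1, h2⟩

/-- A vertex of the block `e` nearest to `i`. -/
noncomputable def gate (e : Block G) (i : V) : V :=
  (Finset.exists_min_image e.verts (fun x => (underlying G).dist i x) e.nonempty).choose

theorem gate_mem (e : Block G) (i : V) : gate e i ∈ e.verts :=
  (Finset.exists_min_image e.verts _ e.nonempty).choose_spec.1

theorem dist_gate_le (e : Block G) (i : V) (hx : x ∈ e.verts) :
    (underlying G).dist i (gate e i) ≤ (underlying G).dist i x :=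
  (Finset.exists_min_image e.verts (fun x => (underlying G).dist i x)
    e.nonempty).choose_spec.2 x hx

theorem gate_of_mem (hG : (underlying G).Connected) (e : Block G) (hi : i ∈ e.verts) :
    gate e i = i := by
  have := dist_gate_le e i hi
  simp only [SimpleGraph.dist_self, nonpos_iff_eq_zero] at this
  exact ((hG.dist_eq_zero_iff).1 this).symm

theorem not_avoid_gate [Fintype V] (hG : (underlying G).Connected) (e : Block G) (hj : j ∈ e.verts)
    (hne : j ≠ gate e i) : ¬ Avoid (underlying G) (gate e i) i j := by
  intro h
  obtain ⟨z, hz, hzd⟩ := exists_adj_dist_lt hG h.ne_left.symm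
  have hze : z ∉ e.verts := fun hze => absurd (dist_gate_le e i hze) (by omega)
  have h1 := avoid_of_dist_le hG hz.ne.symm hzd.le
  refine hze (e.mem_of_insep hG hne.symm (gate_mem e i) hj (.of_adj hz) fun u huz huj => ?_)
  by_cases hu : u = gate e i
  · subst hu
    exact h1.symm.trans h
  · exact (Avoid.of_adj hz huz hu).trans (e.insep (gate_mem e i) hj u hu huj)

theorem gate_ne_iff [Fintype V] (hG : (underlying G).Connected) (e : Block G) (hi : i ∈ e.verts) :
    gate e j ≠ i ↔ ∃ x ∈ e.verts, Avoid (underlying G) i j x := by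
  constructor
  · exact fun h => ⟨gate e j, gate_mem e j, avoid_of_dist_le hG h.symm (dist_gate_le e j hi)⟩
  · rintro ⟨x, hx, h⟩ rfl
    exact not_avoid_gate hG e hx h.ne_right.symm h

theorem separates_gate [Fintype V] (hG : (underlying G).Connected) (e : Block G) (hj : j ∈ e.verts)
    (hne : j ≠ gate e i) (hi : i ≠ gate e i) : Separates G (gate e i) i j :=
  (separates_iff hG).2 ⟨hi.symm, hne.symm, not_avoid_gate hG e hj hne⟩

theorem gate_ne_congr [Fintype V] (hG : (underlying G).Connected) (e : Block G) (hi : i ∈ e.verts)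
    (h : Avoid (underlying G) i x y) : gate e x ≠ i ↔ gate e y ≠ i := by
  simp only [gate_ne_iff hG e hi]
  exact exists_congr fun z => and_congr_right fun _ => ⟨h.symm.trans, h.trans⟩

theorem existsUnique_block_toward [Fintype V] (hG : (underlying G).Connected) (hij : i ≠ j) :
    ∃! e : Block G, i ∈ e.verts ∧ gate e j ≠ i := by
  obtain ⟨z, hz, hzd⟩ := exists_adj_dist_lt hG hij.symm
  obtain ⟨e, he⟩ := exists_block_of_insep hG hz.ne (.of_adj hz)
  have hie : i ∈ e.verts := he i (.of_adj hz.symm) (.refl i)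
  have hge : gate e j ≠ i := (gate_ne_iff hG e hie).2
    ⟨z, he z (.refl z) (.of_adj hz), avoid_of_dist_le hG hz.ne.symm hzd.le⟩
  refine ⟨e, ⟨hie, hge⟩, ?_⟩
  rintro e' ⟨hie', hge'⟩
  have h1 := avoid_of_dist_le hG hge.symm (dist_gate_le e j hie)
  have h2 := avoid_of_dist_le hG hge'.symm (dist_gate_le e' j hie')
  have h3 := h1.symm.trans h2
  have hx := gate_mem e j
  have hx' := gate_mem e' j
  refine (Block.eq_of_mem hG hge hx hie ?_ hie').symm
  refine e'.mem_of_insep hG hge' hx' hie' (fun u hu hu' => ?_) (e.insep hx hie)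
  by_cases hui : u = i
  · exact hui ▸ h3
  · exact (e.insep hx hie u hu hui).trans (e'.insep hie' hx' u hui hu')

theorem connected_branch [Fintype V] (hG : (underlying G).Connected) (e : Block G) :
    ((underlying G).induce
      ((e.verts : Set V) ∪ {j | ∃ x ∈ e.verts, Avoid (underlying G) i j x})).Connected ∧
    ((underlying G).induce {j | ∃ x ∈ e.verts, Avoid (underlying G) i j x}).Preconnected := by
  have h2 : ((underlying G).induce
      {j | ∃ x ∈ e.verts, Avoid (underlying G) i j x}).Preconnected := by
    rintro ⟨s, hs⟩ ⟨t, ht⟩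
    obtain ⟨x, hx, hs⟩ := hs
    obtain ⟨y, hy, ht⟩ := ht
    have hst : Avoid (underlying G) i s t :=
      (hs.trans (e.insep hx hy i hs.ne_right ht.ne_right)).trans ht.symm
    classical
    obtain ⟨p, hp⟩ := hst
    have hmem : ∀ z ∈ p.support, z ∈ {j | ∃ x ∈ e.verts, Avoid (underlying G) i j x} := by
      intro z hz
      refine ⟨y, hy, ?_⟩
      refine Avoid.trans ⟨p.dropUntil z hz, fun h => hp ?_⟩ ht
      exact p.support_dropUntil_subset_support hz h
    exact ⟨p.induce _ hmem⟩
  refine ⟨?_, h2⟩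
  by_cases hne : ∃ j, j ≠ i
  · obtain ⟨j, hj⟩ := hne
    obtain ⟨x, hx, hxi⟩ := e.exists_mem_ne hG hj.symm
    have hne : ((e.verts : Set V) ∩ {j | ∃ x ∈ e.verts, Avoid (underlying G) i j x}).Nonempty :=
      ⟨x, hx, x, hx, .refl hxi.symm⟩
    have := SimpleGraph.induce_union_connected e.noCutVertex.1.preconnected h2 hne
    exact this
  · have : {j | ∃ x ∈ e.verts, Avoid (underlying G) i j x} = ∅ := by
      ext j
      simp only [Set.mem_ofPred_eq, Set.mem_empty_iff_false, iff_false, not_exists, not_and]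
      exact fun x _ h => hne ⟨j, h.ne_left.symm⟩
    rw [this, Set.union_empty]
    exact e.noCutVertex.1

theorem mem_branch_iff [Fintype V] (hG : (underlying G).Connected) (e : Block G) (hi : i ∈ e.verts)
    (hij : j ≠ i) : j ∈ branch i e ↔ gate e j ≠ i := by
  rw [gate_ne_iff hG e hi]
  constructor
  · rintro ⟨S, ⟨heS, -, hS⟩, hj⟩
    simp only [IsCutVertexOf, heS hi, true_and, not_not] at hS
    obtain ⟨x, hx, hxi⟩ := e.exists_mem_ne hG hij.symm
    exact ⟨x, hx, Avoid.of_reachable_induce (S := S \ {i}) (by simp)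
      (hS ⟨j, hj, hij⟩ ⟨x, heS hx, hxi⟩)⟩
  · intro h
    refine ⟨_, ⟨Set.subset_union_left, (connected_branch hG e).1, fun hc => hc.2 ?_⟩,
      Or.inr h⟩
    have : ((e.verts : Set V) ∪ {j | ∃ x ∈ e.verts, Avoid (underlying G) i j x}) \ {i} =
        {j | ∃ x ∈ e.verts, Avoid (underlying G) i j x} := by
      ext y
      constructor
      · rintro ⟨hy | hy, hyi⟩
        · exact ⟨y, hy, .refl (Ne.symm hyi)⟩
        · exact hy
      · rintro ⟨x, hx, hy⟩
        exact ⟨.inr ⟨x, hx, hy⟩, hy.ne_left.symm⟩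
    rw [this]
    exact (connected_branch hG e).2

theorem self_mem_branch (e : Block G) (hi : i ∈ e.verts) :
    i ∈ branch i e := by
  refine ⟨_, ⟨subset_rfl, e.noCutVertex.1, e.noCutVertex.2 i⟩, hi⟩

theorem block_subset_branch [Fintype V] (hG : (underlying G).Connected) (e f : Block G)
    (hi : i ∈ e.verts)
    (hj : j ∈ f.verts) (hji : j ≠ i) (hb : j ∈ branch i e) :
    (f.verts : Set V) ⊆ branch i e := by
  intro k hk
  by_cases hki : k = i
  · subst hki
    exact self_mem_branch e hi
  · rw [mem_branch_iff hG e hi hji] at hb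
    rw [mem_branch_iff hG e hi hki]
    exact (gate_ne_congr hG e hi (f.insep hj hk i hji.symm (Ne.symm hki))).1 hb

end Blocks

section Distances

variable {V : Type*} [Fintype V] {G : Digraph V} {R : Type*} [CommRing R]
  (𝒢 : BlockDatum G R) {v w i j : V}

theorem BlockDatum.m_of_mem (hG : (underlying G).Connected) (e : Block G) (hi : i ∈ e.verts)
    (hj : j ∈ e.verts) : 𝒢.m i j = 𝒢.Dstar e ⟨i, hi⟩ ⟨j, hj⟩ := by
  have h : SameBlock G i j := ⟨e, hi, hj⟩
  rw [BlockDatum.m, dif_pos h]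
  by_cases hij : i = j
  · subst hij
    rw [𝒢.Dstar_diag, 𝒢.Dstar_diag]
  · obtain rfl : e = h.choose :=
      Block.eq_of_mem hG hij hi hj h.choose_spec.1 h.choose_spec.2
    rfl

theorem BlockDatum.d_of_mem (hG : (underlying G).Connected) (e : Block G) (hi : i ∈ e.verts)
    (hj : j ∈ e.verts) : 𝒢.d i j = 𝒢.a e * (𝒢.m i j - 1) := by
  have h : SameBlock G i j := ⟨e, hi, hj⟩
  rw [BlockDatum.d, dif_pos h, 𝒢.m_of_mem hG e hi hj]
  by_cases hij : i = j
  · subst hij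
    simp [BlockDatum.blockDist, 𝒢.Dstar_diag]
  · obtain rfl : e = h.choose :=
      Block.eq_of_mem hG hij hi hj h.choose_spec.1 h.choose_spec.2
    simp [BlockDatum.blockDist]

theorem BlockDatum.m_self (hG : (underlying G).Connected) (i : V) : 𝒢.m i i = 1 := by
  obtain ⟨e, he⟩ := exists_mem_block (G := G) i
  rw [𝒢.m_of_mem hG e he he, 𝒢.Dstar_diag]

theorem BlockDatum.d_self (hG : (underlying G).Connected) (i : V) : 𝒢.d i i = 0 := by
  obtain ⟨e, he⟩ := exists_mem_block (G := G) i
  rw [𝒢.d_of_mem hG e he he, 𝒢.m_self hG, sub_self, mul_zero]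

theorem BlockDatum.m_d_of_separates (hG : (underlying G).Connected) (h : Separates G v i j) :
    𝒢.m i j = 𝒢.m i v * 𝒢.m v j ∧ 𝒢.d i j = 𝒢.d i v + 𝒢.m i v * 𝒢.d v j := by
  induction hn : (underlying G).dist i j using Nat.strong_induction_on generalizing i j v with
  | _ n ih =>
  subst hn
  have hex : ∃ v, Separates G v i j := ⟨v, h⟩
  have hw := hex.choose_spec
  have hm : 𝒢.m i j = 𝒢.m i hex.choose * 𝒢.m hex.choose j := by
    rw [BlockDatum.m, dif_neg (h.not_sameBlock hG), dif_pos hex]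
  have hd : 𝒢.d i j = 𝒢.d i hex.choose + 𝒢.m i hex.choose * 𝒢.d hex.choose j := by
    rw [BlockDatum.d, dif_neg (h.not_sameBlock hG), dif_pos hex]
  rw [hm, hd]
  generalize hex.choose = w at hw
  by_cases hvw : v = w
  · subst hvw
    exact ⟨rfl, rfl⟩
  · rcases h.order hG hvw hw with ⟨h1, h2⟩ | ⟨h1, h2⟩
    · obtain ⟨e1, e2⟩ := ih _ hw.dist_left_lt h1 rfl
      obtain ⟨e3, e4⟩ := ih _ h.dist_right_lt h2 rfl
      rw [e1, e2, e3, e4]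
      constructor <;> ring
    · obtain ⟨e1, e2⟩ := ih _ h.dist_left_lt h1 rfl
      obtain ⟨e3, e4⟩ := ih _ hw.dist_right_lt h2 rfl
      rw [e1, e2, e3, e4]
      constructor <;> ring

theorem BlockDatum.via_gate (hG : (underlying G).Connected) (e : Block G) (hj : j ∈ e.verts) :
    𝒢.m i j = 𝒢.m i (gate e i) * 𝒢.m (gate e i) j ∧
      𝒢.d i j = 𝒢.d i (gate e i) + 𝒢.m i (gate e i) * 𝒢.d (gate e i) j := by
  by_cases h1 : j = gate e i
  · rw [← h1, 𝒢.m_self hG, 𝒢.d_self hG]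
    simp
  by_cases h2 : i = gate e i
  · rw [← h2, 𝒢.m_self hG, 𝒢.d_self hG]
    simp
  exact 𝒢.m_d_of_separates hG (separates_gate hG e hj h1 h2)

theorem BlockDatum.d_to_gate (hG : (underlying G).Connected) (e : Block G) (hj : j ∈ e.verts) :
    𝒢.d j i = 𝒢.d j (gate e i) + 𝒢.m j (gate e i) * 𝒢.d (gate e i) i := by
  by_cases h1 : j = gate e i
  · rw [← h1, 𝒢.m_self hG, 𝒢.d_self hG]
    simp
  by_cases h2 : i = gate e i
  · rw [← h2, 𝒢.d_self hG]
    simp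
  exact (𝒢.m_d_of_separates hG (separates_gate hG e hj h1 h2).symm).2

/-- Along a block `e`, each row of the distance matrix differs from `a_e` times the row of the
multiplicative distance matrix by a constant. -/
theorem BlockDatum.d_sub_d (hG : (underlying G).Connected) (e : Block G) {j k : V}
    (hj : j ∈ e.verts) (hk : k ∈ e.verts) :
    𝒢.d i j - 𝒢.d i k = 𝒢.a e * (𝒢.m i j - 𝒢.m i k) := by
  rw [(𝒢.via_gate hG e hj).1, (𝒢.via_gate hG e hj).2, (𝒢.via_gate hG e hk).1,
    (𝒢.via_gate hG e hk).2, 𝒢.d_of_mem hG e (gate_mem e i) hj,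
    𝒢.d_of_mem hG e (gate_mem e i) hk]
  ring

end Distances

section Kappa

variable {W : Type*} [Fintype W] [DecidableEq W] {R : Type*} [CommRing R]

theorem sum_eq_add_sum_ne (v : W) (f : W → R) :
    ∑ i, f i = f v + ∑ i : {w // w ≠ v}, f i := by
  rw [Fintype.sum_eq_add_sum_compl v, ← Finset.sum_subtype]
  simp

/-- If `τ` is normalized against the column `v` of `M` and all entries of `τᵀ D` equal `α`, then
`det D = α κ(D, v)`. -/
theorem det_eq_mul_kappa (D M : Matrix W W R) (v : W) (τ : W → R) (α : R)
    (hD : ∀ j, ∑ i, τ i * D i j = α) (hM : ∑ i, τ i * M i v = 1) (hv : M v v = 1)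
    (hDv : D v v = 0) : D.det = α * kappa D M v := by
  set D₁ : Matrix W W R := Matrix.of fun i j =>
    D i j + (if i = v then 0 else -M i v) * D v j with hD₁
  set D₂ : Matrix W W R := Matrix.of fun i j =>
    D₁ i j + (if j = v then 0 else -1) * D₁ i v with hD₂
  set σ : W → R := fun k => if k = v then 1 else τ k with hσ
  have e1 : D₁.det = D.det :=
    Matrix.det_eq_of_forall_row_eq_smul_add_const (fun i => if i = v then 0 else -M i v) v
      (by simp) fun i j => rfl
  have e2 : D₂.det = D₁.det := by
    rw [← Matrix.det_transpose D₂, ← Matrix.det_transpose D₁]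
    exact Matrix.det_eq_of_forall_row_eq_smul_add_const (fun j => if j = v then 0 else -1) v
      (by simp) fun i j => rfl
  have e3 := Matrix.det_updateRow_sum D₂ v σ
  have hσ₁ : ∀ j, ∑ k, σ k * D₁ k j = α := by
    intro j
    have h1 := hD j
    have h2 := hM
    rw [sum_eq_add_sum_ne v] at h1 h2 ⊢
    have h3 : ∑ i : {w // w ≠ v}, σ i * D₁ i j =
        ∑ i : {w // w ≠ v}, τ i * D i j - (∑ i : {w // w ≠ v}, τ i * M i v) * D v j := by
      rw [Finset.sum_mul, ← Finset.sum_sub_distrib]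
      refine Finset.sum_congr rfl fun i _ => ?_
      simp only [hσ, hD₁, Matrix.of_apply, i.2, if_false]
      ring
    rw [h3]
    simp only [hσ, hD₁, Matrix.of_apply, if_true]
    rw [hv] at h2
    linear_combination h1 - D v j * h2
  have hrow : ∀ j, (∑ k, σ k • D₂ k) j = if j = v then α else 0 := by
    intro j
    simp only [Finset.sum_apply, Pi.smul_apply, smul_eq_mul, hD₂, Matrix.of_apply, mul_add,
      Finset.sum_add_distrib, hσ₁]
    split_ifs with h
    · simp
    · simp [Finset.sum_neg_distrib, hσ₁]
  rw [Matrix.twoBlockTriangular_det _ (fun w => w ≠ v)] at e3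
  · rw [show σ v = 1 from if_pos rfl, one_smul] at e3
    rw [← e1, ← e2, ← e3, mul_comm]
    congr 1
    · have : Subsingleton {w // ¬ w ≠ v} :=
        ⟨fun a b => Subtype.ext ((not_not.1 a.2).trans (not_not.1 b.2).symm)⟩
      rw [Matrix.det_eq_elem_of_subsingleton _ (⟨v, by simp⟩ : {w // ¬ w ≠ v})]
      simp only [Matrix.toSquareBlockProp_def, Matrix.of_apply, Matrix.updateRow_self]
      exact (hrow v).trans (if_pos rfl)
    · rw [kappa]
      congr 1
      ext i j
      simp only [Matrix.toSquareBlockProp_def, Matrix.of_apply, Matrix.updateRow_ne i.2, hD₂, hD₁,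
        i.2, j.2, if_false, hDv]
      ring
  · intro i hi j hj
    obtain rfl : i = v := not_not.1 hi
    rw [Matrix.updateRow_self, hrow, if_neg hj]

theorem isUnit_kappa_of_isUnit_det (M : Matrix W W R) (a : R) (v : W) (ha : IsUnit a)
    (hM : IsUnit M.det) (hv : M v v = 1) :
    IsUnit (kappa (a • (M - Matrix.of fun _ _ => 1)) M v) := by
  obtain ⟨u, rfl⟩ := ha
  refine Matrix.isUnit_det_of_right_inverse
    (B := Matrix.of fun i j : {w // w ≠ v} => (↑u⁻¹ : R) * M⁻¹ i j) ?_
  have hN := Matrix.mul_nonsing_inv M hM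
  ext i k
  have h1 := congrFun (congrFun hN i) k
  have h2 := congrFun (congrFun hN v) k
  rw [Matrix.mul_apply, sum_eq_add_sum_ne v] at h1 h2
  rw [Matrix.one_apply_ne k.2.symm, hv, one_mul] at h2
  rw [Matrix.mul_apply]
  trans ∑ j : {w // w ≠ v}, (M i j - M i v * M v j) * M⁻¹ j k
  · refine Finset.sum_congr rfl fun j _ => ?_
    simp only [Matrix.of_apply, Matrix.smul_apply, Matrix.sub_apply, smul_eq_mul]
    linear_combination ((M i j - M i v * M v j) * M⁻¹ j k) * u.mul_inv
  simp only [sub_mul, Finset.sum_sub_distrib, mul_assoc, ← Finset.mul_sum]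
  have h4 : (1 : Matrix W W R) i k = (1 : Matrix {w // w ≠ v} {w // w ≠ v} R) i k := by
    simp [Matrix.one_apply, Subtype.ext_iff]
  rw [← h4]
  linear_combination h1 - M i v * h2

end Kappa

section BlockInverse

variable {V : Type*} [Fintype V] [DecidableEq V] {G : Digraph V} {R : Type*} [CommRing R]
  (𝒢 : BlockDatum G R)

theorem BlockDatum.isUnit_det_Dstar (hG : (underlying G).Connected)
    (hM : IsUnit 𝒢.multDist.det) (f : Block G) : IsUnit (𝒢.Dstar f).det := by
  refine Matrix.isUnit_det_of_left_inverse (B := Matrix.of fun j k : f.verts =>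
    ∑ i, if gate f i = k then 𝒢.multDist⁻¹ j i * 𝒢.m i k else 0) ?_
  ext j l
  have h1 := congrFun (congrFun (Matrix.nonsing_inv_mul _ hM) j) l
  have h2 : (1 : Matrix V V R) j l = (1 : Matrix f.verts f.verts R) j l := by
    rw [Matrix.one_apply, Matrix.one_apply]
    exact if_congr Subtype.ext_iff.symm rfl rfl
  rw [← h2, ← h1, Matrix.mul_apply, Matrix.mul_apply]
  simp only [Matrix.of_apply, Finset.sum_mul]
  rw [Finset.sum_comm]
  refine Finset.sum_congr rfl fun i _ => ?_
  rw [Finset.sum_eq_single ⟨gate f i, gate_mem f i⟩]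
  · rw [if_pos rfl, mul_assoc, ← 𝒢.m_of_mem hG f (gate_mem f i) l.2,
      ← (𝒢.via_gate hG f l.2).1]
    rfl
  · intro k _ hk
    rw [if_neg fun h => hk (Subtype.ext h.symm), zero_mul]
  · simp

/-- The inverse of the matrix `D^*_{G_f}`, extended by zero to all vertices. -/
noncomputable def BlockDatum.blockInv (f : Block G) (j k : V) : R :=
  if h : j ∈ f.verts ∧ k ∈ f.verts then (𝒢.Dstar f)⁻¹ ⟨j, h.1⟩ ⟨k, h.2⟩ else 0

/-- The column sums of `blockInv`. -/
noncomputable def BlockDatum.blockTau (f : Block G) (k : V) : R :=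
  ∑ j, 𝒢.blockInv f j k

/-- The quotient `det(D_{𝒢_f}) / κ(D_{𝒢_f})` of a block. -/
noncomputable def BlockDatum.blockAlpha (f : Block G) : R :=
  𝒢.a f * (1 - ∑ k, 𝒢.blockTau f k)

variable {i j k : V}

omit [Fintype V] in
theorem BlockDatum.blockInv_of_left {f : Block G} (h : j ∉ f.verts) : 𝒢.blockInv f j k = 0 :=
  dif_neg fun h' => h h'.1

omit [Fintype V] in
theorem BlockDatum.blockInv_of_right {f : Block G} (h : k ∉ f.verts) : 𝒢.blockInv f j k = 0 :=
  dif_neg fun h' => h h'.2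

theorem BlockDatum.blockTau_of_notMem {f : Block G} (h : k ∉ f.verts) : 𝒢.blockTau f k = 0 :=
  Finset.sum_eq_zero fun _ _ => 𝒢.blockInv_of_right h

omit [DecidableEq V] in
theorem sum_eq_sum_verts (f : Block G) (F : V → R) (hF : ∀ k, k ∉ f.verts → F k = 0) :
    ∑ k, F k = ∑ k : f.verts, F k := by
  rw [Finset.sum_coe_sort f.verts F]
  exact (Finset.sum_subset (Finset.subset_univ _) fun k _ hk => hF k hk).symm

theorem BlockDatum.sum_m_mul_blockInv (hG : (underlying G).Connected)
    (hM : IsUnit 𝒢.multDist.det) (f : Block G) (hi : i ∈ f.verts) (hj : j ∈ f.verts) :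
    ∑ k, 𝒢.m i k * 𝒢.blockInv f k j = if i = j then 1 else 0 := by
  have h1 := congrFun (congrFun (Matrix.mul_nonsing_inv _ (𝒢.isUnit_det_Dstar hG hM f))
    ⟨i, hi⟩) ⟨j, hj⟩
  simp only [Matrix.mul_apply, Matrix.one_apply, Subtype.mk.injEq] at h1
  rw [← h1, sum_eq_sum_verts f]
  · refine Finset.sum_congr rfl fun k _ => ?_
    rw [𝒢.m_of_mem hG f hi k.2, blockInv, dif_pos ⟨k.2, hj⟩]
  · intro k hk
    rw [𝒢.blockInv_of_left hk, mul_zero]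

theorem BlockDatum.sum_blockInv_mul_m (hG : (underlying G).Connected)
    (hM : IsUnit 𝒢.multDist.det) (f : Block G) (hi : i ∈ f.verts) (hj : j ∈ f.verts) :
    ∑ k, 𝒢.blockInv f i k * 𝒢.m k j = if i = j then 1 else 0 := by
  have h1 := congrFun (congrFun (Matrix.nonsing_inv_mul _ (𝒢.isUnit_det_Dstar hG hM f))
    ⟨i, hi⟩) ⟨j, hj⟩
  simp only [Matrix.mul_apply, Matrix.one_apply, Subtype.mk.injEq] at h1
  rw [← h1, sum_eq_sum_verts f]
  · refine Finset.sum_congr rfl fun k _ => ?_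
    rw [𝒢.m_of_mem hG f k.2 hj, blockInv, dif_pos ⟨hi, k.2⟩]
  · intro k hk
    rw [𝒢.blockInv_of_right hk, zero_mul]

theorem BlockDatum.sum_blockTau_mul_m (hG : (underlying G).Connected)
    (hM : IsUnit 𝒢.multDist.det) (f : Block G) (hj : j ∈ f.verts) :
    ∑ k, 𝒢.blockTau f k * 𝒢.m k j = 1 := by
  simp only [blockTau, Finset.sum_mul]
  rw [Finset.sum_comm, Finset.sum_eq_single j]
  · rw [𝒢.sum_blockInv_mul_m hG hM f hj hj, if_pos rfl]
  · intro l _ hl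
    by_cases h : l ∈ f.verts
    · rw [𝒢.sum_blockInv_mul_m hG hM f h hj, if_neg hl]
    · exact Finset.sum_eq_zero fun k _ => by rw [𝒢.blockInv_of_left h, zero_mul]
  · simp

theorem BlockDatum.sum_m_mul_blockInv_gate (hG : (underlying G).Connected)
    (hM : IsUnit 𝒢.multDist.det) (f : Block G) (i j : V) :
    ∑ k, 𝒢.m i k * 𝒢.blockInv f k j =
      if j ∈ f.verts ∧ gate f i = j then 𝒢.m i j else 0 := by
  by_cases hj : j ∈ f.verts
  · have : ∀ k, 𝒢.m i k * 𝒢.blockInv f k j =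
        𝒢.m i (gate f i) * (𝒢.m (gate f i) k * 𝒢.blockInv f k j) := by
      intro k
      by_cases hk : k ∈ f.verts
      · rw [(𝒢.via_gate hG f hk).1, mul_assoc]
      · simp [𝒢.blockInv_of_left hk]
    simp only [this, ← Finset.mul_sum, 𝒢.sum_m_mul_blockInv hG hM f (gate_mem f i) hj, hj,
      true_and]
    split_ifs with h
    · rw [h, mul_one]
    · rw [mul_zero]
  · simp [𝒢.blockInv_of_right hj, hj]

/-- All blocks at `j` but one have `j` as their vertex nearest to `i ≠ j`. -/
theorem sum_block_mem (hG : (underlying G).Connected) (hij : i ≠ j) :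
    ∑ f : Block G, (if j ∈ f.verts then (1 : R) else 0) =
      (∑ f : Block G, if j ∈ f.verts ∧ gate f i = j then (1 : R) else 0) + 1 := by
  obtain ⟨e, he, huniq⟩ := existsUnique_block_toward hG hij.symm
  rw [← sub_eq_iff_eq_add', ← Finset.sum_sub_distrib, Finset.sum_eq_single e]
  · simp [he.1, he.2]
  · intro f _ hf
    by_cases hj : j ∈ f.verts
    · have : gate f i = j := not_not.1 fun h => hf (huniq f ⟨hj, h⟩)
      simp [hj, this]
    · simp [hj]
  · simp

theorem BlockDatum.multDist_inv_apply (hG : (underlying G).Connected)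
    (hM : IsUnit 𝒢.multDist.det) (j k : V) :
    𝒢.multDist⁻¹ j k = ∑ f, 𝒢.blockInv f j k -
      if j = k then (∑ f : Block G, if k ∈ f.verts then (1 : R) else 0) - 1 else 0 := by
  have : 𝒢.multDist⁻¹ = Matrix.of fun j k => ∑ f, 𝒢.blockInv f j k -
      if j = k then (∑ f : Block G, if k ∈ f.verts then (1 : R) else 0) - 1 else 0 := by
    refine Matrix.inv_eq_right_inv ?_
    ext i j
    simp only [Matrix.mul_apply, multDist, Matrix.of_apply, mul_sub, Finset.mul_sum,
      Finset.sum_sub_distrib]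
    rw [Finset.sum_comm]
    simp only [𝒢.sum_m_mul_blockInv_gate hG hM, mul_ite, mul_zero, Finset.sum_ite_eq',
      Finset.mem_univ, if_true]
    have h1 : ∑ f : Block G, (if j ∈ f.verts ∧ gate f i = j then 𝒢.m i j else 0) =
        𝒢.m i j * ∑ f : Block G, if j ∈ f.verts ∧ gate f i = j then (1 : R) else 0 := by
      rw [Finset.mul_sum]
      simp only [mul_ite, mul_one, mul_zero]
    rw [h1]
    by_cases hij : i = j
    · subst hij
      have h2 : ∀ f : Block G, (i ∈ f.verts ∧ gate f i = i) ↔ i ∈ f.verts :=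
        fun f => ⟨fun h => h.1, fun h => ⟨h, gate_of_mem hG f h⟩⟩
      simp only [h2, 𝒢.m_self hG, Matrix.one_apply_eq]
      ring
    · have h2 := sum_block_mem (R := R) hG hij
      rw [Matrix.one_apply_ne hij, h2]
      ring
  rw [this, Matrix.of_apply]

theorem BlockDatum.multDist_inv_of_not_insep (hG : (underlying G).Connected)
    (hM : IsUnit 𝒢.multDist.det) (h : ¬ Insep (underlying G) j k) :
    𝒢.multDist⁻¹ j k = 0 := by
  rw [𝒢.multDist_inv_apply hG hM, if_neg, sub_zero]
  · refine Finset.sum_eq_zero fun f _ => dif_neg fun hf => h (f.insep hf.1 hf.2)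
  · rintro rfl
    exact h (.refl _)

theorem BlockDatum.tauIn_apply (hG : (underlying G).Connected)
    (hM : IsUnit 𝒢.multDist.det) (hik : i ≠ k) :
    𝒢.tauIn k = ∑ f : Block G,
      (𝒢.blockTau f k - if k ∈ f.verts ∧ gate f i = k then 1 else 0) := by
  simp only [tauIn, Matrix.vecMul, dotProduct, one_mul, 𝒢.multDist_inv_apply hG hM,
    Finset.sum_sub_distrib, Finset.sum_ite_eq', Finset.mem_univ, if_true,
    sum_block_mem (R := R) hG hik, blockTau]
  rw [Finset.sum_comm]
  ring

theorem BlockDatum.sum_blockTau_mul_d (hG : (underlying G).Connected)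
    (hM : IsUnit 𝒢.multDist.det) (f : Block G) (i : V) :
    ∑ k, (𝒢.blockTau f k - if k ∈ f.verts ∧ gate f i = k then 1 else 0) * 𝒢.d k i =
      𝒢.blockAlpha f := by
  have h1 := 𝒢.sum_blockTau_mul_m hG hM f (gate_mem f i)
  have h2 : ∀ k, 𝒢.blockTau f k * 𝒢.d k i =
      𝒢.a f * (𝒢.blockTau f k * 𝒢.m k (gate f i)) - 𝒢.a f * 𝒢.blockTau f k +
        𝒢.d (gate f i) i * (𝒢.blockTau f k * 𝒢.m k (gate f i)) := by
    intro k
    by_cases hk : k ∈ f.verts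
    · rw [𝒢.d_to_gate hG f hk, 𝒢.d_of_mem hG f hk (gate_mem f i)]
      ring
    · simp [𝒢.blockTau_of_notMem hk]
  have h3 : ∀ k, (if k ∈ f.verts ∧ gate f i = k then (1 : R) else 0) * 𝒢.d k i =
      if gate f i = k then 𝒢.d k i else 0 := by
    intro k
    by_cases hk : gate f i = k
    · simp [hk, hk ▸ gate_mem f i]
    · simp [hk]
  simp only [sub_mul, h2, h3, Finset.sum_sub_distrib, Finset.sum_add_distrib, ← Finset.mul_sum,
    h1, Finset.sum_ite_eq, Finset.mem_univ, if_true, blockAlpha]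
  ring

open Classical in
/-- The weighted distance sum to `i` over a union `B` of blocks. -/
theorem BlockDatum.sum_tauIn_mul_d (hG : (underlying G).Connected)
    (hM : IsUnit 𝒢.multDist.det) (i : V) (B : Set V)
    (hB : ∀ (f : Block G) (k : V), k ∈ f.verts → k ≠ i → k ∈ B → (f.verts : Set V) ⊆ B) :
    ∑ k, (if k ∈ B then 𝒢.tauIn k * 𝒢.d k i else 0) =
      ∑ f : Block G with (f.verts : Set V) ⊆ B, 𝒢.blockAlpha f := by
  simp only [← 𝒢.sum_blockTau_mul_d hG hM _ i]
  rw [Finset.sum_comm]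
  refine Finset.sum_congr rfl fun k _ => ?_
  by_cases hki : k = i
  · subst hki
    simp [𝒢.d_self hG]
  rw [Finset.sum_filter, 𝒢.tauIn_apply hG hM (Ne.symm hki), Finset.sum_mul,
    show ∀ F : Block G → R, (if k ∈ B then ∑ f, F f else 0) = ∑ f, if k ∈ B then F f else 0 from
      fun F => by split_ifs <;> simp]
  refine Finset.sum_congr rfl fun f _ => ?_
  by_cases hk : k ∈ f.verts
  · have : k ∈ B ↔ (f.verts : Set V) ⊆ B := ⟨hB f k hk hki, fun h => h hk⟩
    simp only [this]
  · simp [𝒢.blockTau_of_notMem hk, hk]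

/-- The sum of the quotients `det / κ` over all blocks. -/
noncomputable def BlockDatum.totalAlpha : R := ∑ f, 𝒢.blockAlpha f

theorem BlockDatum.sum_tauIn_mul_d_univ (hG : (underlying G).Connected)
    (hM : IsUnit 𝒢.multDist.det) (i : V) :
    ∑ k, 𝒢.tauIn k * 𝒢.d k i = 𝒢.totalAlpha := by
  simpa [totalAlpha] using 𝒢.sum_tauIn_mul_d hG hM i Set.univ fun _ _ _ _ _ => Set.subset_univ _

theorem BlockDatum.sum_tauIn_mul_m (hM : IsUnit 𝒢.multDist.det) (j : V) :
    ∑ k, 𝒢.tauIn k * 𝒢.m k j = 1 := by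
  have : 𝒢.tauIn ᵥ* 𝒢.multDist = fun _ => 1 := by
    rw [tauIn, Matrix.vecMul_vecMul, Matrix.nonsing_inv_mul _ hM, Matrix.vecMul_one]
  exact congrFun this j

theorem BlockDatum.det_dist (hG : (underlying G).Connected)
    (hM : IsUnit 𝒢.multDist.det) (v : V) :
    𝒢.dist.det = 𝒢.totalAlpha * 𝒢.kappaG v :=
  det_eq_mul_kappa _ _ v 𝒢.tauIn _ (𝒢.sum_tauIn_mul_d_univ hG hM) (𝒢.sum_tauIn_mul_m hM v)
    (𝒢.m_self hG v) (𝒢.d_self hG v)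

theorem BlockDatum.det_blockDist (hG : (underlying G).Connected)
    (hM : IsUnit 𝒢.multDist.det) (f : Block G) (v : f.verts) :
    (𝒢.blockDist f).det = 𝒢.blockAlpha f * 𝒢.kappaBlock f v := by
  have h1 : ∀ j : f.verts, ∑ i : f.verts, 𝒢.blockTau f i * 𝒢.Dstar f i j = 1 := by
    intro j
    rw [← 𝒢.sum_blockTau_mul_m hG hM f j.2, sum_eq_sum_verts f]
    · exact Finset.sum_congr rfl fun k _ => by rw [𝒢.m_of_mem hG f k.2 j.2]
    · intro k hk
      rw [𝒢.blockTau_of_notMem hk, zero_mul]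
  refine det_eq_mul_kappa _ _ v (fun k => 𝒢.blockTau f k) _ (fun j => ?_) (h1 v)
    (𝒢.Dstar_diag f v) (by simp [blockDist, 𝒢.Dstar_diag])
  have h2 := sum_eq_sum_verts f (𝒢.blockTau f) fun k hk => 𝒢.blockTau_of_notMem hk
  have h3 : ∀ i : f.verts, 𝒢.blockTau f i * 𝒢.blockDist f i j =
      𝒢.a f * (𝒢.blockTau f i * 𝒢.Dstar f i j) - 𝒢.a f * 𝒢.blockTau f i := by
    intro i
    simp only [blockDist, Matrix.smul_apply, Matrix.sub_apply, Matrix.of_apply, smul_eq_mul]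
    ring
  simp only [h3, Finset.sum_sub_distrib, ← Finset.mul_sum, h1, blockAlpha, h2]
  ring

theorem BlockDatum.isUnit_kappaBlock (hG : (underlying G).Connected)
    (ha : ∀ e, IsUnit (𝒢.a e)) (hM : IsUnit 𝒢.multDist.det) (f : Block G) (v : f.verts) :
    IsUnit (𝒢.kappaBlock f v) :=
  isUnit_kappa_of_isUnit_det _ _ v (ha f) (𝒢.isUnit_det_Dstar hG hM f) (𝒢.Dstar_diag f v)

end BlockInverse

section Laplacian

variable {V : Type*} [Fintype V] [DecidableEq V] {G : Digraph V} {R : Type*} [CommRing R]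
  (𝒢 : BlockDatum G R) {i j k : V}

open Classical in
/-- The inverse weight of the block at `i` leading to `j`, and `0` for `j = i`. -/
noncomputable def BlockDatum.invWeight (i j : V) : R :=
  if j = i then 0
  else if h : ∃ e : Block G, i ∈ e.verts ∧ j ∈ branch i e then (𝒢.a h.choose)⁻¹ʳ else 0

theorem BlockDatum.invWeight_self (i : V) : 𝒢.invWeight i i = 0 := if_pos rfl

theorem BlockDatum.invWeight_eq (hG : (underlying G).Connected) {e : Block G}
    (hi : i ∈ e.verts) (hji : j ≠ i) (he : gate e j ≠ i) :
    𝒢.invWeight i j = (𝒢.a e)⁻¹ʳ := by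
  have h : ∃ e : Block G, i ∈ e.verts ∧ j ∈ branch i e :=
    ⟨e, hi, (mem_branch_iff hG e hi hji).2 he⟩
  rw [invWeight, if_neg hji, dif_pos h]
  have hc := h.choose_spec
  rw [(existsUnique_block_toward hG hji.symm).unique ⟨hi, he⟩
    ⟨hc.1, (mem_branch_iff hG _ hc.1 hji).1 hc.2⟩]

theorem BlockDatum.invWeight_of_mem (hG : (underlying G).Connected) {e : Block G}
    (hi : i ∈ e.verts) (hj : j ∈ e.verts) (hji : j ≠ i) :
    𝒢.invWeight i j = (𝒢.a e)⁻¹ʳ :=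
  𝒢.invWeight_eq hG hi hji (by rwa [gate_of_mem hG e hj])

theorem BlockDatum.invWeight_symm (hG : (underlying G).Connected)
    (h : Insep (underlying G) i j) : 𝒢.invWeight i j = 𝒢.invWeight j i := by
  by_cases hij : j = i
  · rw [hij]
  · obtain ⟨e, hi, hj⟩ := (sameBlock_iff hG).2 h
    rw [𝒢.invWeight_of_mem hG hi hj hij, 𝒢.invWeight_of_mem hG hj hi (Ne.symm hij)]

theorem BlockDatum.invWeight_congr (hG : (underlying G).Connected)
    (h : Insep (underlying G) j k) (hj : j ≠ i) (hk : k ≠ i) :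
    𝒢.invWeight i j = 𝒢.invWeight i k := by
  obtain ⟨e, ⟨hi, he⟩, -⟩ := existsUnique_block_toward hG hj.symm
  rw [𝒢.invWeight_eq hG hi hj he, 𝒢.invWeight_eq hG hi hk
    ((gate_ne_congr hG e hi (h i hj.symm hk.symm)).1 he)]

theorem BlockDatum.C_apply (hG : (underlying G).Connected) (v₀ : V)
    (b : (f : Block G) → f.verts) (i j : V) :
    𝒢.C v₀ b i j = 𝒢.beta v₀ b i - 𝒢.invWeight i j := by
  rw [C, Matrix.of_apply, invWeight]
  split_ifs with h1 h2
  · rw [sub_zero]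
  · rfl
  · obtain ⟨e, he, -⟩ := existsUnique_block_toward hG (Ne.symm h1)
    exact absurd ⟨e, he.1, (mem_branch_iff hG e he.1 h1).2 he.2⟩ h2

theorem BlockDatum.laplacianOff_eq (hG : (underlying G).Connected)
    (hM : IsUnit 𝒢.multDist.det) (hij : i ≠ j) :
    𝒢.laplacianOff i j = -(𝒢.invWeight i j * 𝒢.multDist⁻¹ i j) := by
  rw [laplacianOff]
  split_ifs with h
  · rw [𝒢.invWeight_of_mem hG h.choose_spec.1 h.choose_spec.2 hij.symm, neg_mul]
  · rw [𝒢.multDist_inv_of_not_insep hG hM fun h' => h ((sameBlock_iff hG).2 h'), mul_zero,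
      neg_zero]

theorem BlockDatum.laplacian_apply (hG : (underlying G).Connected)
    (hM : IsUnit 𝒢.multDist.det) (i j : V) :
    𝒢.laplacian i j = (if i = j then ∑ k, 𝒢.invWeight k j * 𝒢.multDist⁻¹ k j else 0) -
      𝒢.invWeight i j * 𝒢.multDist⁻¹ i j := by
  rw [laplacian, Matrix.of_apply]
  split_ifs with h
  · subst h
    rw [𝒢.invWeight_self, zero_mul, sub_zero, ← Finset.sum_erase Finset.univ (a := i)
      (by rw [𝒢.invWeight_self, zero_mul]), ← Finset.sum_neg_distrib]
    refine Finset.sum_congr rfl fun k hk => ?_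
    rw [𝒢.laplacianOff_eq hG hM (Finset.ne_of_mem_erase hk), neg_neg]
  · rw [𝒢.laplacianOff_eq hG hM h, zero_sub]

theorem BlockDatum.sum_multDist_inv (k : V) :
    ∑ j, 𝒢.multDist⁻¹ j k = 𝒢.tauIn k := by
  simp [tauIn, Matrix.vecMul, dotProduct]

theorem BlockDatum.C_mul_multDist_inv (hG : (underlying G).Connected)
    (hM : IsUnit 𝒢.multDist.det) (v₀ : V) (b : (f : Block G) → f.verts) :
    𝒢.C v₀ b * 𝒢.multDist⁻¹ = -𝒢.laplacian + 𝒢.C v₀ b * Matrix.diagonal 𝒢.tauIn := by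
  ext i k
  rw [Matrix.add_apply, Matrix.neg_apply, Matrix.mul_diagonal, Matrix.mul_apply,
    𝒢.laplacian_apply hG hM]
  simp only [𝒢.C_apply hG, sub_mul, Finset.sum_sub_distrib, ← Finset.mul_sum,
    𝒢.sum_multDist_inv]
  have key : ∑ j, (𝒢.invWeight i k - 𝒢.invWeight i j) * 𝒢.multDist⁻¹ j k =
      𝒢.invWeight i k * 𝒢.multDist⁻¹ i k -
        (if i = k then ∑ l, 𝒢.invWeight l k * 𝒢.multDist⁻¹ l k else 0) := by
    by_cases hik : i = k
    · subst hik
      rw [if_pos rfl, 𝒢.invWeight_self, zero_mul, zero_sub, ← Finset.sum_neg_distrib]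
      refine Finset.sum_congr rfl fun j _ => ?_
      by_cases h : Insep (underlying G) j i
      · rw [𝒢.invWeight_symm hG h]
        ring
      · rw [𝒢.multDist_inv_of_not_insep hG hM h]
        ring
    · rw [if_neg hik, sub_zero, Finset.sum_eq_single i]
      · rw [𝒢.invWeight_self, sub_zero]
      · intro j _ hj
        by_cases h : Insep (underlying G) j k
        · rw [𝒢.invWeight_congr hG h hj (Ne.symm hik), sub_self, zero_mul]
        · rw [𝒢.multDist_inv_of_not_insep hG hM h, mul_zero]
      · simp
  simp only [sub_mul, Finset.sum_sub_distrib, ← Finset.mul_sum, 𝒢.sum_multDist_inv] at key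
  linear_combination key

theorem BlockDatum.invWeight_mul_d_sub_d (hG : (underlying G).Connected)
    (ha : ∀ e, IsUnit (𝒢.a e)) (h : Insep (underlying G) j k) (hjk : j ≠ k) (i : V) :
    𝒢.invWeight j k * (𝒢.d i j - 𝒢.d i k) = 𝒢.m i j - 𝒢.m i k := by
  obtain ⟨e, hj, hk⟩ := (sameBlock_iff hG).2 h
  rw [𝒢.invWeight_of_mem hG hj hk hjk.symm, 𝒢.d_sub_d hG e hj hk, ← mul_assoc,
    Ring.inverse_mul_cancel _ (ha e), one_mul]

theorem BlockDatum.dist_mul_laplacian (hG : (underlying G).Connected)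
    (ha : ∀ e, IsUnit (𝒢.a e)) (hM : IsUnit 𝒢.multDist.det) :
    𝒢.dist * 𝒢.laplacian = -1 + 𝒢.multDist * Matrix.diagonal 𝒢.tauIn := by
  ext i k
  have h1 := congrFun (congrFun (Matrix.mul_nonsing_inv _ hM) i) k
  rw [Matrix.mul_apply] at h1
  rw [Matrix.add_apply, Matrix.neg_apply, Matrix.mul_diagonal, Matrix.mul_apply]
  simp only [𝒢.laplacian_apply hG hM, mul_sub, Finset.sum_sub_distrib, mul_ite, mul_zero,
    Finset.sum_ite_eq', Finset.mem_univ, if_true, dist, multDist, Matrix.of_apply] at h1 ⊢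
  have key : ∀ j, 𝒢.d i k * (𝒢.invWeight j k * (Matrix.of 𝒢.m)⁻¹ j k) -
      𝒢.d i j * (𝒢.invWeight j k * (Matrix.of 𝒢.m)⁻¹ j k) =
      𝒢.m i k * (Matrix.of 𝒢.m)⁻¹ j k - 𝒢.m i j * (Matrix.of 𝒢.m)⁻¹ j k := by
    intro j
    by_cases hjk : j = k
    · rw [hjk, sub_self, sub_self]
    by_cases h : Insep (underlying G) j k
    · linear_combination (-(Matrix.of 𝒢.m)⁻¹ j k) * 𝒢.invWeight_mul_d_sub_d hG ha h hjk i
    · rw [show (Matrix.of 𝒢.m)⁻¹ j k = 0 from 𝒢.multDist_inv_of_not_insep hG hM h]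
      ring
  rw [Finset.mul_sum, ← Finset.sum_sub_distrib, Finset.sum_congr rfl fun j _ => key j,
    Finset.sum_sub_distrib, h1, ← Finset.mul_sum]
  rw [show ∑ j, (Matrix.of 𝒢.m)⁻¹ j k = 𝒢.tauIn k from 𝒢.sum_multDist_inv k]
  ring

/-- All columns of `D (invWeight) + D^*` agree. -/
theorem BlockDatum.sum_d_mul_invWeight (hG : (underlying G).Connected)
    (ha : ∀ e, IsUnit (𝒢.a e)) (i j j' : V) :
    ∑ k, 𝒢.d i k * 𝒢.invWeight k j + 𝒢.m i j =
      ∑ k, 𝒢.d i k * 𝒢.invWeight k j' + 𝒢.m i j' := by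
  obtain ⟨p⟩ := hG.preconnected j j'
  induction p with
  | nil => rfl
  | @cons j l _ hjl _ ih =>
    rw [← ih]
    have hs := Insep.of_adj hjl
    have key : ∑ k, 𝒢.d i k * (𝒢.invWeight k j - 𝒢.invWeight k l) = 𝒢.m i l - 𝒢.m i j := by
      rw [Fintype.sum_eq_add j l hjl.ne]
      · rw [𝒢.invWeight_self, 𝒢.invWeight_self, 𝒢.invWeight_symm hG hs.symm]
        linear_combination -𝒢.invWeight_mul_d_sub_d hG ha hs hjl.ne i
      · rintro k ⟨hkj, hkl⟩
        rw [𝒢.invWeight_congr hG hs hkj.symm hkl.symm, sub_self, mul_zero]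
    simp only [mul_sub, Finset.sum_sub_distrib] at key
    linear_combination key

theorem BlockDatum.sum_laplacian_mul_d (hG : (underlying G).Connected)
    (ha : ∀ e, IsUnit (𝒢.a e)) (hM : IsUnit 𝒢.multDist.det) (i : V) :
    ∑ k, 𝒢.laplacian i k * 𝒢.d k i = 𝒢.tauOut i - 1 := by
  have h1 := congrFun (congrFun (Matrix.nonsing_inv_mul _ hM) i) i
  rw [Matrix.mul_apply, Matrix.one_apply_eq] at h1
  have h2 : ∀ k, 𝒢.laplacian i k * 𝒢.d k i =
      𝒢.multDist⁻¹ i k - 𝒢.multDist⁻¹ i k * 𝒢.multDist k i := by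
    intro k
    rw [𝒢.laplacian_apply hG hM]
    by_cases hik : i = k
    · subst hik
      rw [𝒢.d_self hG, multDist, Matrix.of_apply, 𝒢.m_self hG]
      ring
    rw [if_neg hik, multDist, Matrix.of_apply]
    by_cases h : Insep (underlying G) i k
    · have h3 := 𝒢.invWeight_mul_d_sub_d hG ha h.symm (Ne.symm hik) k
      rw [𝒢.d_self hG, 𝒢.m_self hG, ← 𝒢.invWeight_symm hG h] at h3
      linear_combination (Matrix.of 𝒢.m)⁻¹ i k * h3
    · rw [show (Matrix.of 𝒢.m)⁻¹ i k = 0 from 𝒢.multDist_inv_of_not_insep hG hM h]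
      ring
  rw [Finset.sum_congr rfl fun k _ => h2 k, Finset.sum_sub_distrib, h1]
  simp [tauOut, Matrix.mulVec, dotProduct]

theorem BlockDatum.sum_invWeight_mul_tauIn_mul_d (hG : (underlying G).Connected)
    (ha : ∀ e, IsUnit (𝒢.a e)) (hM : IsUnit 𝒢.multDist.det) (hD : IsUnit 𝒢.dist.det) (v₀ : V)
    (b : (f : Block G) → f.verts) (i : V) :
    ∑ k, 𝒢.invWeight i k * (𝒢.tauIn k * 𝒢.d k i) = 𝒢.totalAlpha * 𝒢.beta v₀ b i := by
  classical
  have h1 : 𝒢.totalAlpha * (𝒢.kappaG v₀ * 𝒢.dist.det⁻¹ʳ) = 1 := by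
    rw [← mul_assoc, ← 𝒢.det_dist hG hM v₀, Ring.mul_inverse_cancel _ hD]
  rw [beta, ← mul_assoc, h1, one_mul]
  trans ∑ e : Block G with i ∈ e.verts, (𝒢.a e)⁻¹ʳ *
    ∑ k, if k ∈ branch i e then 𝒢.tauIn k * 𝒢.d k i else 0
  · simp only [Finset.mul_sum]
    rw [Finset.sum_comm]
    refine Finset.sum_congr rfl fun k _ => ?_
    by_cases hki : k = i
    · subst hki
      simp [𝒢.d_self hG]
    obtain ⟨e, ⟨hi, he⟩, huniq⟩ := existsUnique_block_toward hG (Ne.symm hki)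
    rw [Finset.sum_eq_single e, 𝒢.invWeight_eq hG hi hki he,
      if_pos ((mem_branch_iff hG e hi hki).2 he)]
    · intro f hf hfe
      have hif : i ∈ f.verts := (Finset.mem_filter.1 hf).2
      rw [if_neg, mul_zero]
      rw [mem_branch_iff hG f hif hki]
      exact fun h => hfe (huniq f ⟨hif, h⟩)
    · exact fun h => absurd (by simpa using hi) h
  · refine Finset.sum_congr (by ext; simp) fun e he => ?_
    have hie : i ∈ e.verts := (Finset.mem_filter.1 he).2
    rw [𝒢.sum_tauIn_mul_d hG hM i (branch i e) fun f k hk hki hkb =>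
      block_subset_branch hG e f hie hk hki hkb]
    refine congrArg _ (Finset.sum_congr (by ext; simp) fun f _ => ?_)
    rw [𝒢.det_blockDist hG hM f (b f), mul_assoc,
      Ring.mul_inverse_cancel _ (𝒢.isUnit_kappaBlock hG ha hM f (b f)), mul_one]

theorem BlockDatum.dist_inv_eq (hG : (underlying G).Connected)
    (ha : ∀ e, IsUnit (𝒢.a e)) (hM : IsUnit 𝒢.multDist.det) (hD : IsUnit 𝒢.dist.det) (v₀ : V)
    (b : (f : Block G) → f.verts) :
    𝒢.dist⁻¹ = 𝒢.totalAlpha⁻¹ʳ • Matrix.vecMulVec 𝒢.tauOut 𝒢.tauIn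
      - 𝒢.laplacian + 𝒢.C v₀ b * Matrix.diagonal 𝒢.tauIn := by
  have hα : IsUnit 𝒢.totalAlpha := by
    rw [𝒢.det_dist hG hM v₀] at hD
    exact isUnit_of_mul_isUnit_left hD
  obtain ⟨x, hx⟩ : ∃ x : V → R, ∀ i j,
      𝒢.dist⁻¹ i j = -𝒢.laplacian i j + (x i - 𝒢.invWeight i j) * 𝒢.tauIn j := by
    set Y := 𝒢.dist⁻¹ with hY
    have hYD : Y * 𝒢.dist = 1 := Matrix.nonsing_inv_mul _ hD
    set r : V → R := fun i => ∑ k, 𝒢.d i k * 𝒢.invWeight k v₀ + 𝒢.m i v₀ with hr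
    have h1 : 𝒢.dist * Matrix.of 𝒢.invWeight = -𝒢.multDist + Matrix.vecMulVec r (fun _ => 1) := by
      ext i j
      have := 𝒢.sum_d_mul_invWeight hG ha i j v₀
      simp only [Matrix.mul_apply, dist, multDist, Matrix.of_apply, Matrix.add_apply,
        Matrix.neg_apply, Matrix.vecMulVec_apply, hr]
      linear_combination this
    have h2 : Matrix.of 𝒢.invWeight =
        -(Y * 𝒢.multDist) + Matrix.vecMulVec (Y *ᵥ r) (fun _ => 1) := by
      rw [← Matrix.mul_vecMulVec, ← mul_neg, ← mul_add, ← h1, ← mul_assoc, hYD, one_mul]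
    have h3 : 𝒢.laplacian = -Y + Y * 𝒢.multDist * Matrix.diagonal 𝒢.tauIn := by
      rw [mul_assoc, ← mul_neg_one Y, ← mul_add, ← 𝒢.dist_mul_laplacian hG ha hM, ← mul_assoc,
        hYD, one_mul]
    refine ⟨Y *ᵥ r, fun i j => ?_⟩
    have h4 := congrFun (congrFun h2 i) j
    have h5 := congrFun (congrFun h3 i) j
    simp only [Matrix.of_apply, Matrix.add_apply, Matrix.neg_apply, Matrix.vecMulVec_apply,
      Matrix.mul_diagonal, mul_one] at h4 h5
    linear_combination h5 + 𝒢.tauIn j * h4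
  have hxi : ∀ i, x i = 𝒢.totalAlpha⁻¹ʳ * 𝒢.tauOut i + 𝒢.beta v₀ b i := by
    intro i
    have h1 := congrFun (congrFun (Matrix.nonsing_inv_mul _ hD) i) i
    rw [Matrix.mul_apply, Matrix.one_apply_eq] at h1
    have h2 : ∀ k, 𝒢.dist⁻¹ i k * 𝒢.dist k i = -(𝒢.laplacian i k * 𝒢.d k i) +
        x i * (𝒢.tauIn k * 𝒢.d k i) - 𝒢.invWeight i k * (𝒢.tauIn k * 𝒢.d k i) := by
      intro k
      rw [hx, dist, Matrix.of_apply]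
      ring
    simp only [h2, Finset.sum_sub_distrib, Finset.sum_add_distrib, Finset.sum_neg_distrib,
      ← Finset.mul_sum, 𝒢.sum_laplacian_mul_d hG ha hM, 𝒢.sum_tauIn_mul_d_univ hG hM,
      𝒢.sum_invWeight_mul_tauIn_mul_d hG ha hM hD v₀ b] at h1
    have h3 := Ring.inverse_mul_cancel _ hα
    linear_combination 𝒢.totalAlpha⁻¹ʳ * h1 + (𝒢.beta v₀ b i - x i) * h3
  ext i j
  rw [hx, hxi, Matrix.add_apply, Matrix.sub_apply, Matrix.smul_apply, Matrix.vecMulVec_apply,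
    Matrix.mul_diagonal, 𝒢.C_apply hG, smul_eq_mul]
  ring

end Laplacian

end AddMult

theorem mainTheorem7 {V : Type*} [Fintype V] [DecidableEq V] (G : Digraph V)
    (hG : AddMult.StronglyConnected G) {R : Type*} [CommRing R] (𝒢 : AddMult.BlockDatum G R)
    (ha : ∀ e, IsUnit (𝒢.a e)) (hDstar : IsUnit 𝒢.multDist.det) (hD : IsUnit 𝒢.dist.det)
    (v₀ : V) (b : (f : AddMult.Block G) → f.verts) :
    (IsUnit (𝒢.kappaG v₀) ∧ ∀ f, IsUnit (𝒢.kappaBlock f (b f))) ∧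
    𝒢.C v₀ b =
      (-𝒢.laplacian + 𝒢.C v₀ b * Matrix.diagonal 𝒢.tauIn) * 𝒢.multDist ∧
    𝒢.dist⁻¹ =
      (𝒢.alpha v₀)⁻¹ʳ • Matrix.vecMulVec 𝒢.tauOut 𝒢.tauIn
        - 𝒢.laplacian + 𝒢.C v₀ b * Matrix.diagonal 𝒢.tauIn := by
  have : Nonempty V := ⟨v₀⟩
  have hc := hG.connected
  have hdet := 𝒢.det_dist hc hDstar v₀
  have hκ : IsUnit (𝒢.kappaG v₀) := by
    rw [hdet] at hD
    exact isUnit_of_mul_isUnit_right hD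
  refine ⟨⟨hκ, fun f => 𝒢.isUnit_kappaBlock hc ha hDstar f (b f)⟩, ?_, ?_⟩
  · rw [← 𝒢.C_mul_multDist_inv hc hDstar v₀ b, mul_assoc, Matrix.nonsing_inv_mul _ hDstar, mul_one]
  · have : 𝒢.alpha v₀ = 𝒢.totalAlpha := by
      rw [AddMult.BlockDatum.alpha, hdet, mul_assoc, Ring.mul_inverse_cancel _ hκ, mul_one]
    rw [this]
    exact 𝒢.dist_inv_eq hc ha hDstar hD v₀ b
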